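/- Let $F$ be a field of characteristic $0$. All Lie algebras below are soluble and finite-dimensional over $F$. A Lie algebra $P$ is called primitive if it has a minimal ideal $A$ with $C_P(A)=A$. A Schunck class is an isomorphism-closed class $\mathfrak X$ of Lie algebras that is closed under quotients and contains every Lie algebra $L$ all of whose primitive quotients are in $\mathfrak X$. An $\mathfrak X$-projector of $L$ is a subalgebra $U\le L$ such that for every ideal $I$ of $L$ the subalgebra $(U+I)/I$ is $\mathfrak X$-maximal in $L/I$, that is, belongs to $\mathfrak X$ and is not properly contained in a subalgebra of $L/I$ belonging to $\mathfrak X$. A Schunck class $\mathfrak H$ strongly contains a Schunck class $\mathfrak K$ if for every Lie algebra $L$ and every $\mathfrak H$-projector $H$ of $L$, every $\mathfrak K$-projector of $H$ is a $\mathfrak K$-projector of $L$. Theorem. If $\mathfrak H\supseteq\mathfrak K$ are Schunck classes of soluble Lie algebras over $F$, then $\mathfrak H$ strongly contains $\mathfrak K$. -/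

import Mathlib

universe u v

namespace SchunckLie

/-- A class of Lie algebras over the field `F` (its closure under isomorphism is a field of
`IsSchunckClass` below). -/
abbrev LieClass (F : Type u) [Field F] : Type (max u (v + 1)) :=
  ∀ (L : Type v) [LieRing L] [LieAlgebra F L], Prop

/-- The canonical homomorphism `L → L / I` of Lie algebras. -/
def quotientMk {F : Type u} [Field F] {L : Type v} [LieRing L] [LieAlgebra F L]
    (I : LieIdeal F L) : L →ₗ⁅F⁆ (L ⧸ I) where
  toFun := fun x => LieSubmodule.Quotient.mk x
  map_add' := fun _ _ => rfl
  map_smul' := fun _ _ => rfl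
  map_lie' := fun {x y} => LieSubmodule.Quotient.mk_bracket I x y

/-- A Lie algebra is primitive if it has a minimal (nonzero) ideal that is its own
centraliser. -/
def IsPrimitive (F : Type u) [Field F] (L : Type v) [LieRing L] [LieAlgebra F L] : Prop :=
  ∃ A : LieIdeal F L, IsAtom A ∧ ∀ x : L, x ∈ A ↔ ∀ a ∈ A, ⁅x, a⁆ = 0

/-- A Schunck class of finite-dimensional soluble Lie algebras over `F`: an isomorphism-closed
class, closed under quotients, which contains every finite-dimensional soluble Lie algebra all of
whose primitive quotients belong to it. -/
structure IsSchunckClass {F : Type u} [Field F] (X : LieClass.{u, v} F) : Prop where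
  finiteDimensional : ∀ (L : Type v) [LieRing L] [LieAlgebra F L], X L → FiniteDimensional F L
  soluble : ∀ (L : Type v) [LieRing L] [LieAlgebra F L], X L → LieAlgebra.IsSolvable L
  iso : ∀ (L M : Type v) [LieRing L] [LieAlgebra F L] [LieRing M] [LieAlgebra F M],
    (L ≃ₗ⁅F⁆ M) → X L → X M
  quotient : ∀ (L : Type v) [LieRing L] [LieAlgebra F L] (I : LieIdeal F L), X L → X (L ⧸ I)
  primitively_closed : ∀ (L : Type v) [LieRing L] [LieAlgebra F L] [FiniteDimensional F L]
    [LieAlgebra.IsSolvable L],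
    (∀ I : LieIdeal F L, IsPrimitive F (L ⧸ I) → X (L ⧸ I)) → X L

/-- `U` is an `X`-maximal subalgebra of `L`: it belongs to `X`, and no strictly larger subalgebra
of `L` does. -/
def IsMaximalSubalgebra {F : Type u} [Field F] (X : LieClass.{u, v} F)
    {L : Type v} [LieRing L] [LieAlgebra F L] (U : LieSubalgebra F L) : Prop :=
  X U ∧ ∀ V : LieSubalgebra F L, U ≤ V → X V → V = U

/-- `U` is an `X`-projector of `L`: for every ideal `I` of `L`, the image `(U + I) / I` of `U` in
`L / I` is an `X`-maximal subalgebra of `L / I`. -/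
def IsProjector {F : Type u} [Field F] (X : LieClass.{u, v} F)
    {L : Type v} [LieRing L] [LieAlgebra F L] (U : LieSubalgebra F L) : Prop :=
  ∀ I : LieIdeal F L, IsMaximalSubalgebra X (U.map (quotientMk I))

/-- `X` strongly contains `Y`: for every finite-dimensional soluble `L` and every `X`-projector
`H` of `L`, every `Y`-projector of `H` (viewed as a subalgebra of `L`) is a `Y`-projector
of `L`. -/
def StronglyContains {F : Type u} [Field F] (X Y : LieClass.{u, v} F) : Prop :=
  ∀ (L : Type v) [LieRing L] [LieAlgebra F L] [FiniteDimensional F L] [LieAlgebra.IsSolvable L]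
    (H : LieSubalgebra F L), IsProjector X H →
    ∀ K : LieSubalgebra F H, IsProjector Y K → IsProjector Y (K.map H.incl)

end SchunckLie

/-! Induct on the dimension of `L`. Let `R` be the image in `L` of an `𝔥`-projector and `K` the
image of a `𝔎`-projector of it. Induction handles all proper quotients, so only `𝔎`-maximality of
`K` in `L` itself is at stake; let `K ≤ V` with `V` in `𝔎`, and assume `R ≠ L`. If `R + A ≠ L` for
some minimal ideal `A`, then `A` is abelian, so the `𝔥`-maximal `R` is an `𝔥`-projector of `R + A`
(`IsMaximalSubalgebra.isProjector`). Induction applies to `R + A`, which contains `V` because `V + A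
= K + A`. If `R` supplements every minimal ideal, characteristic `0` enters: by Lie's theorem `[L,
L]` centralises minimal ideals, which forces `R` to be abelian. A nontrivial Schunck class contains
all abelian algebras, so either `V = 0`, or `R` is in `𝔎`; then `R = K`, and `𝔥`-maximality of `R`
gives `V = R`. -/

namespace SchunckLie

/-! ### Quotients, factorisation and restriction of homomorphisms. -/

section Prelim

variable {F : Type u} [Field F]

theorem quotientMk_surjective {L : Type v} [LieRing L] [LieAlgebra F L] (I : LieIdeal F L) :
    Function.Surjective (quotientMk I) :=
  Quot.mk_surjective

theorem quotientMk_eq_zero {L : Type v} [LieRing L] [LieAlgebra F L] (I : LieIdeal F L) {x : L} :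
    quotientMk I x = 0 ↔ x ∈ I :=
  LieSubmodule.Quotient.mk_eq_zero' (N := I)

theorem quotientMk_eq {L : Type v} [LieRing L] [LieAlgebra F L] (I : LieIdeal F L) {x y : L} :
    quotientMk I x = quotientMk I y ↔ x - y ∈ I := by
  rw [← quotientMk_eq_zero, map_sub, sub_eq_zero]

theorem ker_quotientMk {L : Type v} [LieRing L] [LieAlgebra F L] (I : LieIdeal F L) :
    (quotientMk I).ker = I := by
  ext x
  rw [LieHom.mem_ker, quotientMk_eq_zero]

theorem subalgebra_map_map {L M N : Type v} [LieRing L] [LieAlgebra F L] [LieRing M] [LieAlgebra F M]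
    [LieRing N] [LieAlgebra F N] (g : M →ₗ⁅F⁆ N) (f : L →ₗ⁅F⁆ M) (U : LieSubalgebra F L) :
    (U.map f).map g = U.map (g.comp f) := by
  ext x
  simp [LieSubalgebra.mem_map]

/-- A homomorphism whose kernel contains that of a surjection `f` factors through `f`. -/
theorem exists_comp_eq {L M N : Type v} [LieRing L] [LieAlgebra F L] [LieRing M] [LieAlgebra F M]
    [LieRing N] [LieAlgebra F N] (f : L →ₗ⁅F⁆ M) (hf : Function.Surjective f) (g : L →ₗ⁅F⁆ N)
    (h : f.ker ≤ g.ker) : ∃ k : M →ₗ⁅F⁆ N, ∀ x, k (f x) = g x := by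
  have key : ∀ x y, f x = f y → g x = g y := fun x y hxy => by
    have : x - y ∈ g.ker := h (by rw [LieHom.mem_ker, map_sub, hxy, sub_self])
    rwa [LieHom.mem_ker, map_sub, sub_eq_zero] at this
  obtain ⟨s, hs⟩ := hf.hasRightInverse
  refine ⟨{ toFun := fun m => g (s m), map_add' := ?_, map_smul' := ?_, map_lie' := ?_ },
    fun x => key _ _ (hs _)⟩
  · intro x y
    rw [← map_add]
    exact key _ _ (by simp only [map_add, hs _])
  · intro c x
    rw [RingHom.id_apply, ← map_smul]
    exact key _ _ (by simp only [map_smul, hs _])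
  · intro x y
    rw [← LieHom.map_lie]
    exact key _ _ (by simp only [LieHom.map_lie, hs _])

/-- The isomorphism `L / ker f ≃ M` induced by a surjection `f : L → M`. -/
theorem exists_equiv_comp_quotientMk {L M : Type v} [LieRing L] [LieAlgebra F L] [LieRing M]
    [LieAlgebra F M] (f : L →ₗ⁅F⁆ M) (hf : Function.Surjective f) :
    ∃ e : (L ⧸ f.ker) ≃ₗ⁅F⁆ M, (e : (L ⧸ f.ker) →ₗ⁅F⁆ M).comp (quotientMk f.ker) = f := by
  obtain ⟨k, hk⟩ := exists_comp_eq (quotientMk f.ker) (quotientMk_surjective _) f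
    (ker_quotientMk _).le
  refine ⟨LieEquiv.ofBijective k ⟨?_, fun y => ?_⟩, ?_⟩
  · refine (injective_iff_map_eq_zero k).2 fun x hx => ?_
    obtain ⟨x, rfl⟩ := quotientMk_surjective _ x
    rwa [hk, ← LieHom.mem_ker, ← quotientMk_eq_zero] at hx
  · obtain ⟨x, rfl⟩ := hf y
    exact ⟨_, hk x⟩
  · ext x
    exact hk x

theorem solvable_quotient {L : Type v} [LieRing L] [LieAlgebra F L] [LieAlgebra.IsSolvable L]
    (I : LieIdeal F L) : LieAlgebra.IsSolvable (L ⧸ I) :=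
  (quotientMk_surjective I).lieAlgebra_isSolvable

theorem solvable_subalgebra {L : Type v} [LieRing L] [LieAlgebra F L] [LieAlgebra.IsSolvable L]
    (U : LieSubalgebra F L) : LieAlgebra.IsSolvable U :=
  Function.Injective.lieAlgebra_isSolvable (f := U.incl) Subtype.val_injective

/-- The restriction of a homomorphism to a subalgebra, as a map onto the image. -/
def restrictMap {L M : Type v} [LieRing L] [LieAlgebra F L] [LieRing M] [LieAlgebra F M]
    (f : L →ₗ⁅F⁆ M) (U : LieSubalgebra F L) : U →ₗ⁅F⁆ U.map f where
  toFun x := ⟨f (x : L), (LieSubalgebra.mem_map _ _ _).2 ⟨x, x.2, rfl⟩⟩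
  map_add' x y := Subtype.ext (map_add f (x : L) y)
  map_smul' c x := Subtype.ext (f.map_smul c (x : L))
  map_lie' {x y} := Subtype.ext (LieHom.map_lie f (x : L) y)

theorem restrictMap_surjective {L M : Type v} [LieRing L] [LieAlgebra F L] [LieRing M]
    [LieAlgebra F M] (f : L →ₗ⁅F⁆ M) (U : LieSubalgebra F L) :
    Function.Surjective (restrictMap f U) := by
  rintro ⟨y, hy⟩
  obtain ⟨x, hx, rfl⟩ := (LieSubalgebra.mem_map _ _ _).1 hy
  exact ⟨⟨x, hx⟩, rfl⟩

end Prelim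

/-! ### Projectors and closure properties of Schunck classes. -/

section Projector

variable {F : Type u} [Field F] {X : LieClass.{u, v} F}

theorem IsSchunckClass.of_surjective (hX : IsSchunckClass X) {L M : Type v} [LieRing L] [LieAlgebra F L] [LieRing M]
    [LieAlgebra F M] (f : L →ₗ⁅F⁆ M) (hf : Function.Surjective f) (h : X L) : X M := by
  obtain ⟨e, -⟩ := exists_equiv_comp_quotientMk f hf
  exact hX.iso _ _ e (hX.quotient L f.ker h)

theorem IsSchunckClass.map (hX : IsSchunckClass X) {L M : Type v} [LieRing L] [LieAlgebra F L] [LieRing M]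
    [LieAlgebra F M] (f : L →ₗ⁅F⁆ M) {U : LieSubalgebra F L} (h : X U) : X (U.map f) :=
  hX.of_surjective _ (restrictMap_surjective f U) h

theorem IsSchunckClass.of_map (hX : IsSchunckClass X) {L M : Type v} [LieRing L] [LieAlgebra F L] [LieRing M]
    [LieAlgebra F M] (f : L →ₗ⁅F⁆ M) (hf : Function.Injective f) {U : LieSubalgebra F L}
    (h : X (U.map f)) : X U :=
  hX.iso _ _ (LieEquiv.ofBijective (restrictMap f U)
    ⟨fun _ _ hxy => Subtype.ext (hf (congrArg Subtype.val hxy)),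
      restrictMap_surjective f U⟩).symm h

theorem IsMaximalSubalgebra.map_equiv (hX : IsSchunckClass X) {L M : Type v} [LieRing L] [LieAlgebra F L] [LieRing M]
    [LieAlgebra F M] {U : LieSubalgebra F L} (hU : IsMaximalSubalgebra X U) (f : L →ₗ⁅F⁆ M)
    (hf : Function.Bijective f) : IsMaximalSubalgebra X (U.map f) := by
  refine ⟨hX.map f hU.1, fun V hUV hV => ?_⟩
  have hVc : (V.comap f).map f = V := by
    ext y
    obtain ⟨x, rfl⟩ := hf.2 y
    simp only [LieSubalgebra.mem_map, LieSubalgebra.mem_comap]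
    exact ⟨fun ⟨z, hz, h⟩ => h ▸ hz, fun h => ⟨x, h, rfl⟩⟩
  rw [← hU.2 (V.comap f) (LieSubalgebra.map_le_iff_le_comap.1 hUV)
    (hX.of_map f hf.1 (hVc.symm ▸ hV)), hVc]

theorem IsProjector.isMaximal_map (hX : IsSchunckClass X) {L M : Type v} [LieRing L] [LieAlgebra F L] [LieRing M]
    [LieAlgebra F M] {U : LieSubalgebra F L} (hU : IsProjector X U) (f : L →ₗ⁅F⁆ M)
    (hf : Function.Surjective f) : IsMaximalSubalgebra X (U.map f) := by
  obtain ⟨e, he⟩ := exists_equiv_comp_quotientMk f hf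
  have := (hU f.ker).map_equiv hX (e : (L ⧸ f.ker) →ₗ⁅F⁆ M) e.bijective
  rwa [subalgebra_map_map, he] at this

theorem IsProjector.map (hX : IsSchunckClass X) {L M : Type v} [LieRing L] [LieAlgebra F L] [LieRing M]
    [LieAlgebra F M] {U : LieSubalgebra F L} (hU : IsProjector X U) (f : L →ₗ⁅F⁆ M)
    (hf : Function.Surjective f) : IsProjector X (U.map f) := by
  intro I
  rw [subalgebra_map_map]
  exact hU.isMaximal_map hX _ ((quotientMk_surjective I).comp hf)

theorem IsProjector.isMaximal (hX : IsSchunckClass X) {L : Type v} [LieRing L] [LieAlgebra F L]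
    {U : LieSubalgebra F L} (hU : IsProjector X U) : IsMaximalSubalgebra X U := by
  have := hU.isMaximal_map hX (LieHom.id : L →ₗ⁅F⁆ L) Function.surjective_id
  rwa [show U.map LieHom.id = U by ext; simp [LieSubalgebra.mem_map]] at this

/-- The image of an `X`-projector is `X`-maximal in the range of any homomorphism. -/
theorem IsProjector.eq_map_of_le_range (hX : IsSchunckClass X) {H L : Type v} [LieRing H] [LieAlgebra F H] [LieRing L]
    [LieAlgebra F L] (f : H →ₗ⁅F⁆ L) {K : LieSubalgebra F H} (hK : IsProjector X K)
    {V : LieSubalgebra F L} (hKV : K.map f ≤ V) (hV : X V) (hVf : V ≤ f.range) :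
    V = K.map f := by
  have hmax := (hK.isMaximal_map hX _ f.surjective_rangeRestrict).2 (V.comap f.range.incl) ?_ ?_
  · refine le_antisymm (fun x hx => ?_) hKV
    have : (⟨x, hVf hx⟩ : f.range) ∈ K.map f.rangeRestrict := hmax ▸ hx
    obtain ⟨y, hy, hyx⟩ := (LieSubalgebra.mem_map _ _ _).1 this
    exact (LieSubalgebra.mem_map _ _ _).2 ⟨y, hy, congrArg Subtype.val hyx⟩
  · rw [← LieSubalgebra.map_le_iff_le_comap, subalgebra_map_map]
    exact hKV
  · refine hX.of_map f.range.incl Subtype.val_injective ?_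
    rwa [show (V.comap f.range.incl).map f.range.incl = V from ?_]
    ext x
    simp only [LieSubalgebra.mem_map, LieSubalgebra.mem_comap, LieSubalgebra.coe_incl]
    exact ⟨fun ⟨y, hy, h⟩ => h ▸ hy, fun h => ⟨⟨x, hVf h⟩, h, rfl⟩⟩

/-- If `L = U + A` with `A` an abelian ideal, then an `X`-maximal `U` is an `X`-projector. -/
theorem IsMaximalSubalgebra.isProjector (hX : IsSchunckClass X) {L : Type v} [LieRing L] [LieAlgebra F L]
    [FiniteDimensional F L] [LieAlgebra.IsSolvable L] {U : LieSubalgebra F L}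
    (hU : IsMaximalSubalgebra X U) (A : LieIdeal F L) (hA : ∀ a ∈ A, ∀ b ∈ A, ⁅a, b⁆ = 0)
    (hUA : ∀ x : L, ∃ y ∈ U, x - y ∈ A) : IsProjector X U := by
  intro I
  refine ⟨hX.map _ hU.1, fun V hUV hV => ?_⟩
  set π := quotientMk I
  -- Take `W` of least dimension in `S`. Each primitive quotient of `W` turns out to be a quotient
  -- of `V` or of `U`, so `W` is in `X`, and maximality of `U` gives `W = U`.
  let S : Set (LieSubalgebra F L) := {W | U ≤ W ∧ W.map π = V}
  have hS : S.Nonempty := by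
    refine ⟨V.comap π, LieSubalgebra.map_le_iff_le_comap.1 hUV, ?_⟩
    ext y
    obtain ⟨x, rfl⟩ := quotientMk_surjective I y
    simp only [LieSubalgebra.mem_map, LieSubalgebra.mem_comap]
    exact ⟨fun ⟨z, hz, h⟩ => h ▸ hz, fun h => ⟨x, h, rfl⟩⟩
  obtain ⟨W, ⟨hUW, hWV⟩, hmin⟩ :=
    WellFounded.has_min (measure fun W : LieSubalgebra F L => Module.finrank F W).wf S hS
  suffices hW : X W by rw [← hWV, hU.2 W hUW hW]
  have := solvable_subalgebra W
  refine hX.primitively_closed W fun N ⟨S₀, hS₀, hcent⟩ => ?_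
  set q := quotientMk N
  have hq : Function.Surjective q := quotientMk_surjective N
  let p := restrictMap π W
  have hp : Function.Surjective p := restrictMap_surjective π W
  have hdisj : ∀ J : LieIdeal F (W ⧸ N), S₀ ≤ J ∨ ∀ b ∈ J, ∀ s ∈ S₀, ⁅b, s⁆ = 0 := by
    intro J
    rcases hS₀.le_iff.1 (inf_le_left : S₀ ⊓ J ≤ S₀) with h | h
    · refine Or.inr fun b hb s hs => ?_
      have : ⁅b, s⁆ ∈ S₀ ⊓ J := ⟨lie_mem_right F _ S₀ _ _ hs, lie_mem_left F _ J _ _ hb⟩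
      rwa [h, LieSubmodule.mem_bot] at this
    · exact Or.inl (inf_eq_left.1 h)
  by_cases hJ : p.ker.map q = ⊥
  · obtain ⟨k, hk⟩ := exists_comp_eq p hp q (LieIdeal.map_eq_bot_iff.1 hJ)
    refine hX.of_surjective (k.comp (LieSubalgebra.inclusion hWV.ge)) ?_ hV
    intro y
    obtain ⟨w, rfl⟩ := hq y
    have hw : (p w : L ⧸ I) ∈ V := hWV ▸ (p w).2
    exact ⟨⟨p w, hw⟩, hk w⟩
  have hSJ : S₀ ≤ p.ker.map q := by
    refine (hdisj _).elim id fun h => ?_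
    exact ((hS₀.le_iff.1 fun b hb => (hcent b).2 (h b hb)).resolve_left hJ).ge
  let B : LieIdeal F (W ⧸ N) := (A.comap W.incl).map q
  have hBab : ∀ b ∈ B, ∀ c ∈ B, ⁅b, c⁆ = 0 := by
    intro b hb c hc
    obtain ⟨⟨b, hbA⟩, rfl⟩ := LieIdeal.mem_map_of_surjective hq hb
    obtain ⟨⟨c, hcA⟩, rfl⟩ := LieIdeal.mem_map_of_surjective hq hc
    rw [← LieHom.map_lie]
    have : ⁅b, c⁆ = 0 := Subtype.ext (hA _ hbA _ hcA)
    rw [this, map_zero]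
  have hBS : B ≤ S₀ := fun b hb => (hcent b).2 <|
    (hdisj B).elim (fun h s hs => hBab b hb s (h hs)) fun h => h b hb
  let U₁ : LieSubalgebra F W := U.comap W.incl
  -- `W₁` is `U + N`. Modulo `N`, the ideal `A ∩ W` falls into `S₀`, hence into the image of
  -- `p.ker`. So `W = W₁ + p.ker`, `W₁` still maps onto `V`, and minimality forces `W₁ = W`.
  let W₁ : LieSubalgebra F W := (U₁.map q).comap q
  have hmem : W₁.map W.incl ∈ S := by
    refine ⟨fun u hu => ?_, le_antisymm ?_ fun y hy => ?_⟩
    · exact (LieSubalgebra.mem_map _ _ _).2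
        ⟨⟨u, hUW hu⟩, (LieSubalgebra.mem_map _ _ _).2 ⟨⟨u, hUW hu⟩, hu, rfl⟩, rfl⟩
    · rw [← hWV, LieSubalgebra.map_le_iff_le_comap]
      intro x hx
      obtain ⟨w, -, rfl⟩ := (LieSubalgebra.mem_map _ _ _).1 hx
      exact (LieSubalgebra.mem_map _ _ _).2 ⟨w, w.2, rfl⟩
    · rw [← hWV] at hy
      obtain ⟨w, hw, rfl⟩ := (LieSubalgebra.mem_map _ _ _).1 hy
      obtain ⟨u, hu, hwu⟩ := hUA w
      let w' : W := ⟨w, hw⟩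
      let u' : W := ⟨u, hUW hu⟩
      have hd : q (w' - u') ∈ p.ker.map q :=
        hSJ (hBS (LieIdeal.mem_map (I := A.comap W.incl) (f := q) (x := w' - u') hwu))
      obtain ⟨⟨k, hk⟩, hkd⟩ := LieIdeal.mem_map_of_surjective hq hd
      refine (LieSubalgebra.mem_map _ _ _).2 ⟨w' - k, (LieSubalgebra.mem_map _ _ _).2
        ⟨w' - k, (LieSubalgebra.mem_map _ _ _).2 ⟨u', hu, ?_⟩, rfl⟩, ?_⟩
      · change q u' = q (w' - k)
        have hkd : q k = q (w' - u') := hkd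
        rw [map_sub, hkd, map_sub, sub_sub_cancel]
      · have hk0 : p k = 0 := LieHom.mem_ker.1 hk
        have : π (k : L) = 0 := congrArg Subtype.val hk0
        change π (w - (k : L)) = π w
        rw [map_sub, this, sub_zero]
  have hW₁ : W₁ = ⊤ := by
    have hfin := not_lt.1 (show ¬ Module.finrank F (W₁.map W.incl) < Module.finrank F W from
      hmin _ hmem)
    have hle : (W₁.map W.incl).toSubmodule ≤ W.toSubmodule := by
      rintro x hx
      obtain ⟨w, -, rfl⟩ := (LieSubalgebra.mem_map _ _ _).1 hx
      exact w.2
    have heq := Submodule.eq_of_le_of_finrank_le hle hfin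
    refine eq_top_iff.2 fun w _ => ?_
    have hw : (w : L) ∈ (W₁.map W.incl).toSubmodule := heq ▸ w.2
    obtain ⟨z, hz, hzw⟩ := (LieSubalgebra.mem_map _ _ _).1 hw
    rwa [← Subtype.ext hzw]
  refine hX.of_surjective (q.comp (LieSubalgebra.inclusion hUW)) (fun y => ?_) hU.1
  obtain ⟨w, rfl⟩ := hq y
  have hw : w ∈ W₁ := hW₁ ▸ LieSubalgebra.mem_top w
  obtain ⟨u, hu, huw⟩ := (LieSubalgebra.mem_map _ _ _).1 hw
  exact ⟨⟨u, hu⟩, huw⟩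

/-- A Schunck class is trivial or contains all finite-dimensional abelian Lie algebras. -/
theorem IsSchunckClass.subsingleton_or_abelian (hX : IsSchunckClass X) :
    (∀ (L : Type v) [LieRing L] [LieAlgebra F L], X L → Subsingleton L) ∨
    ∀ (M : Type v) [LieRing M] [LieAlgebra F M] [FiniteDimensional F M],
      (∀ x y : M, ⁅x, y⁆ = 0) → X M := by
  refine or_iff_not_imp_left.2 fun h => ?_
  push Not at h
  obtain ⟨L, _, _, hL, hnt⟩ := h
  have := hX.finiteDimensional L hL
  have := hX.soluble L hL
  intro M _ _ _ hM
  have : IsLieAbelian M := ⟨hM⟩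
  refine hX.primitively_closed M fun I ⟨A, hA, hcent⟩ => ?_
  have hab : ∀ x y : M ⧸ I, ⁅x, y⁆ = 0 := by
    intro x y
    obtain ⟨x, rfl⟩ := quotientMk_surjective I x
    obtain ⟨y, rfl⟩ := quotientMk_surjective I y
    rw [← LieHom.map_lie, hM, map_zero]
  obtain ⟨m, hmA, hm0⟩ : ∃ m ∈ A, m ≠ 0 := by
    by_contra! h
    exact hA.1 ((LieSubmodule.eq_bot_iff A).2 h)
  -- Every line of an abelian algebra is an ideal, so the minimal ideal `A` is a line; being
  -- self-centralising, it is all of `M ⧸ I`.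
  let C : LieIdeal F (M ⧸ I) :=
    { Submodule.span F {m} with
      lie_mem := fun {x y} _ => by
        rw [hab]
        exact zero_mem (Submodule.span F {m}) }
  have hmC : m ∈ C := Submodule.mem_span_singleton_self m
  have hCA : C ≤ A := (Submodule.span_singleton_le_iff_mem m A.toSubmodule).2 hmA
  have hCeq : C = A := (hA.le_iff.1 hCA).resolve_left fun h => hm0 (by
    rwa [h, LieSubmodule.mem_bot] at hmC)
  -- Solubility makes the derived algebra proper, so `L` has a one-dimensional quotient.
  obtain ⟨φ, hφ0, hφ⟩ := Submodule.exists_le_ker_of_lt_top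
    (LieAlgebra.derivedSeries F L 1).toSubmodule
    (lt_top_iff_ne_top.2 fun h => (LieAlgebra.derivedSeries_lt_top_of_solvable F L).ne
      ((LieSubmodule.toSubmodule_eq_top _).1 h))
  let g : L →ₗ⁅F⁆ M ⧸ I :=
    { (LinearMap.toSpanSingleton F (M ⧸ I) m).comp φ with
      map_lie' := fun {x y} => by
        have : φ ⁅x, y⁆ = 0 :=
          hφ (LieSubmodule.lie_mem_lie (LieSubmodule.mem_top x) (LieSubmodule.mem_top y))
        rw [hab]
        change φ ⁅x, y⁆ • m = 0
        rw [this, zero_smul] }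
  refine hX.of_surjective g (fun y => ?_) hL
  have hy : y ∈ C := hCeq ▸ (hcent y).2 fun a _ => hab y a
  obtain ⟨c, rfl⟩ := Submodule.mem_span_singleton.1 hy
  obtain ⟨x, hx⟩ := LinearMap.surjective hφ0 c
  exact ⟨x, congrArg (· • m) hx⟩

end Projector

/-! ### Lie's theorem and minimal ideals in characteristic `0`. -/

section MinimalIdeals
open TensorProduct

/-- A nonzero finite-dimensional module over a soluble Lie algebra in characteristic `0` contains a
nonzero vector killed by all brackets. -/
theorem exists_ne_zero_lie_lie_eq_zero (F : Type u) [Field F] [CharZero F] (L : Type v) [LieRing L]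
    [LieAlgebra F L] [LieAlgebra.IsSolvable L] (V : Type w) [AddCommGroup V] [Module F V]
    [LieRingModule L V] [LieModule F L V] [FiniteDimensional F V] [Nontrivial V] :
    ∃ v : V, v ≠ 0 ∧ ∀ x y : L, ⁅⁅x, y⁆, v⁆ = 0 := by
  classical
  let E := AlgebraicClosure F
  have : CharZero E := charZero_of_injective_algebraMap (algebraMap F E).injective
  -- Over the algebraic closure there is a common eigenvector `t`, which brackets kill. Elements of
  -- `L` act coordinatewise in an `F`-basis of `E`, so any nonzero coordinate of `t` serves over
  -- `F`.
  obtain ⟨χ, hχ⟩ := LieModule.exists_nontrivial_weightSpace_of_isSolvable E (E ⊗[F] L) (E ⊗[F] V)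
  obtain ⟨⟨t, ht⟩, ht0⟩ := exists_ne (0 : LieModule.weightSpace (E ⊗[F] V) χ)
  rw [LieModule.mem_weightSpace] at ht
  have ht0' : t ≠ 0 := fun h => ht0 (Subtype.ext h)
  let e := TensorProduct.equivFinsuppOfBasisLeft (N := V) (Module.Basis.ofVectorSpace F E)
  have hcomm : ∀ (z : L) (s : E ⊗[F] V) i, e ⁅(1 : E) ⊗ₜ[F] z, s⁆ i = ⁅z, e s i⁆ := by
    intro z s i
    induction s with
    | zero => simp
    | tmul a b => simp [e]
    | add a b ha hb => simp [ha, hb]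
  obtain ⟨i, hi⟩ : ∃ i, e t i ≠ 0 := by
    by_contra! h
    exact ht0' (e.injective (by ext i; simp [h i]))
  refine ⟨e t i, hi, fun x y => ?_⟩
  have hxy : (1 : E) ⊗ₜ[F] ⁅x, y⁆ = ⁅(1 : E) ⊗ₜ[F] x, (1 : E) ⊗ₜ[F] y⁆ := by
    rw [LieAlgebra.ExtendScalars.bracket_tmul, one_mul]
  have ht₂ : ⁅(1 : E) ⊗ₜ[F] ⁅x, y⁆, t⁆ = 0 := by
    refine (congrArg (⁅·, t⁆) hxy).trans ((lie_lie ((1 : E) ⊗ₜ[F] x) ((1 : E) ⊗ₜ[F] y) t).trans ?_)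
    rw [ht, ht, lie_smul, lie_smul, ht, ht, smul_comm, sub_self]
  rw [← hcomm, ht₂, map_zero, Finsupp.zero_apply]

variable {F : Type u} [Field F] {L : Type v} [LieRing L] [LieAlgebra F L]

/-- In characteristic `0` the derived algebra of a soluble Lie algebra centralises every minimal
ideal. -/
theorem lie_lie_eq_zero_of_isAtom [CharZero F] [FiniteDimensional F L] [LieAlgebra.IsSolvable L]
    {A : LieIdeal F L} (hA : IsAtom A) (x y : L) {a : L} (ha : a ∈ A) : ⁅⁅x, y⁆, a⁆ = 0 := by
  let C : LieIdeal F L :=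
    { carrier := {a | a ∈ A ∧ ∀ x y : L, ⁅⁅x, y⁆, a⁆ = 0}
      add_mem' := fun ha hb => ⟨add_mem ha.1 hb.1, fun x y => by
        rw [lie_add, ha.2, hb.2, add_zero]⟩
      zero_mem' := ⟨zero_mem _, fun x y => lie_zero _⟩
      smul_mem' := fun c a ha => ⟨A.smul_mem c ha.1, fun x y => by rw [lie_smul, ha.2, smul_zero]⟩
      lie_mem := fun {z a} ha => ⟨A.lie_mem ha.1, fun x y => by
        rw [leibniz_lie, ha.2, ha.2, lie_zero, add_zero]⟩ }
  have : Nontrivial A := (LieSubmodule.nontrivial_iff_ne_bot F L L).2 hA.1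
  obtain ⟨v, hv0, hv⟩ := exists_ne_zero_lie_lie_eq_zero F L (A : LieSubmodule F L L)
  have hvC : (v : L) ∈ C := ⟨v.2, fun x y => congrArg Subtype.val (hv x y)⟩
  rcases hA.le_iff.1 (show C ≤ A from fun a ha => ha.1) with h | h
  · rw [h, LieSubmodule.mem_bot] at hvC
    exact absurd (Subtype.ext hvC) hv0
  · rw [← h] at ha
    exact ha.2 x y

/-- Minimal ideals of soluble Lie algebras in characteristic `0` are abelian. -/
theorem lie_eq_zero_of_isAtom [CharZero F] [FiniteDimensional F L] [LieAlgebra.IsSolvable L]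
    {A : LieIdeal F L} (hA : IsAtom A) {a b : L} (ha : a ∈ A) (hb : b ∈ A) : ⁅a, b⁆ = 0 := by
  let C : LieIdeal F L :=
    { carrier := {a | a ∈ A ∧ ∀ b ∈ A, ⁅a, b⁆ = 0}
      add_mem' := fun ha hb => ⟨add_mem ha.1 hb.1, fun c hc => by
        rw [add_lie, ha.2 c hc, hb.2 c hc, add_zero]⟩
      zero_mem' := ⟨zero_mem _, fun c _ => zero_lie _⟩
      smul_mem' := fun r a ha => ⟨A.smul_mem r ha.1, fun c hc => by
        rw [smul_lie, ha.2 c hc, smul_zero]⟩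
      lie_mem := fun {z a} ha => ⟨A.lie_mem ha.1, fun c hc =>
        lie_lie_eq_zero_of_isAtom hA z a hc⟩ }
  rcases hA.le_iff.1 (show C ≤ A from fun a ha => ha.1) with h | h
  · have : ⁅a, b⁆ ∈ C := ⟨A.lie_mem hb, fun c hc => lie_lie_eq_zero_of_isAtom hA a b hc⟩
    rwa [h, LieSubmodule.mem_bot] at this
  · rw [← h] at ha
    exact ha.2 b hb

end MinimalIdeals

/-! ### Supplements of minimal ideals and the induction. -/

section StrongContainment

variable {F : Type u} [Field F]

/-- The sum of a subalgebra and an ideal. -/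
def addIdeal {L : Type v} [LieRing L] [LieAlgebra F L] (U : LieSubalgebra F L)
    (A : LieIdeal F L) : LieSubalgebra F L :=
  (U.map (quotientMk A)).comap (quotientMk A)

theorem mem_addIdeal {L : Type v} [LieRing L] [LieAlgebra F L] {U : LieSubalgebra F L}
    {A : LieIdeal F L} {x : L} : x ∈ addIdeal U A ↔ ∃ u ∈ U, x - u ∈ A := by
  simp only [addIdeal, LieSubalgebra.mem_comap, LieSubalgebra.mem_map]
  refine exists_congr fun u => and_congr_right fun _ => ?_
  rw [eq_comm, quotientMk_eq]

theorem le_addIdeal {L : Type v} [LieRing L] [LieAlgebra F L] (U : LieSubalgebra F L)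
    (A : LieIdeal F L) : U ≤ addIdeal U A := fun u hu =>
  mem_addIdeal.2 ⟨u, hu, by rw [sub_self]; exact zero_mem A⟩

theorem finrank_lt_of_ne_top {L : Type v} [LieRing L] [LieAlgebra F L] [FiniteDimensional F L]
    {U : LieSubalgebra F L} (h : U ≠ ⊤) : Module.finrank F U < Module.finrank F L :=
  Submodule.finrank_lt (s := U.toSubmodule) fun h' => h ((LieSubalgebra.toSubmodule_eq_top U).1 h')

theorem finrank_quotient_lt {L : Type v} [LieRing L] [LieAlgebra F L] [FiniteDimensional F L]
    {I : LieIdeal F L} (h : I ≠ ⊥) : Module.finrank F (L ⧸ I) < Module.finrank F L := by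
  have h₁ := Submodule.finrank_quotient_add_finrank I.toSubmodule
  have h₂ : 0 < Module.finrank F I.toSubmodule := by
    have : Nontrivial I := (LieSubmodule.nontrivial_iff_ne_bot F L L).2 h
    exact Module.finrank_pos (R := F) (M := I)
  change Module.finrank F (L ⧸ I.toSubmodule) < _
  omega

theorem exists_isAtom_le {L : Type v} [LieRing L] [LieAlgebra F L] [FiniteDimensional F L]
    {I : LieIdeal F L} (h : I ≠ ⊥) : ∃ A : LieIdeal F L, IsAtom A ∧ A ≤ I := by
  have : IsAtomic (LieIdeal F L) :=
    have := LieSubmodule.wellFoundedLT_of_isArtinian F L L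
    isAtomic_of_orderBot_wellFounded_lt wellFounded_lt
  exact (IsAtomic.eq_bot_or_exists_atom_le I).resolve_left h

/-- A subalgebra supplementing every minimal ideal `A` of a soluble Lie algebra in
characteristic `0` is abelian or everything. -/
theorem lie_eq_zero_of_forall_addIdeal_eq_top [CharZero F] {L : Type v} [LieRing L]
    [LieAlgebra F L] [FiniteDimensional F L] [LieAlgebra.IsSolvable L] {R : LieSubalgebra F L}
    (hR : R ≠ ⊤) (h : ∀ A : LieIdeal F L, IsAtom A → addIdeal R A = ⊤) {A : LieIdeal F L}
    (hA : IsAtom A) {x y : L} (hx : x ∈ R) (hy : y ∈ R) : ⁅x, y⁆ = 0 := by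
  -- The centraliser of `A` in `R` is an ideal because `L = R + A`. A minimal ideal `B` inside it
  -- would lie in `R`, giving `R = R + B = L`; so it is zero, yet it contains `[R, R]`.
  let C : LieIdeal F L :=
    { carrier := {c | c ∈ R ∧ ∀ a ∈ A, ⁅c, a⁆ = 0}
      add_mem' := fun ha hb => ⟨add_mem ha.1 hb.1, fun c hc => by
        rw [add_lie, ha.2 c hc, hb.2 c hc, add_zero]⟩
      zero_mem' := ⟨zero_mem _, fun c _ => zero_lie _⟩
      smul_mem' := fun r a ha => ⟨R.smul_mem r ha.1, fun c hc => by
        rw [smul_lie, ha.2 c hc, smul_zero]⟩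
      lie_mem := fun {z c} hc => by
        obtain ⟨r, hr, hzr⟩ := mem_addIdeal.1 (h A hA ▸ LieSubalgebra.mem_top z)
        have hzc : ⁅z, c⁆ = ⁅r, c⁆ := by
          rw [← sub_eq_zero, ← sub_lie, ← lie_skew, hc.2 _ hzr, neg_zero]
        exact ⟨hzc ▸ R.lie_mem hr hc.1, fun a ha => lie_lie_eq_zero_of_isAtom hA z c ha⟩ }
  have hxy : ⁅x, y⁆ ∈ C := ⟨R.lie_mem hx hy, fun a ha => lie_lie_eq_zero_of_isAtom hA x y ha⟩
  by_contra hne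
  obtain ⟨B, hB, hBC⟩ := exists_isAtom_le (I := C) fun hC => hne (by
    rwa [hC, LieSubmodule.mem_bot] at hxy)
  refine hR (eq_top_iff.2 fun z _ => ?_)
  obtain ⟨r, hr, hzr⟩ := mem_addIdeal.1 (h B hB ▸ LieSubalgebra.mem_top z)
  have : z - r + r ∈ R := add_mem (hBC hzr).1 hr
  rwa [sub_add_cancel] at this

/-- The abelian case of the induction, where `f.range` supplements every minimal ideal. -/
theorem eq_of_forall_addIdeal_eq_top [CharZero F] {X Y : LieClass.{u, v} F}
    (hY : IsSchunckClass Y)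
    (hsub : ∀ (L : Type v) [LieRing L] [LieAlgebra F L], Y L → X L)
    {L : Type v} [LieRing L] [LieAlgebra F L] [FiniteDimensional F L] [LieAlgebra.IsSolvable L]
    {H : Type v} [LieRing H] [LieAlgebra F H] (f : H →ₗ⁅F⁆ L) {K : LieSubalgebra F H}
    (hf : IsMaximalSubalgebra X f.range) (hK : IsProjector Y K) (hR : f.range ≠ ⊤)
    (h : ∀ A : LieIdeal F L, IsAtom A → addIdeal f.range A = ⊤) {A : LieIdeal F L}
    (hA : IsAtom A) {V : LieSubalgebra F L} (hKV : K.map f ≤ V) (hV : Y V) : V = K.map f := by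
  rcases hY.subsingleton_or_abelian with hY₀ | hY₁
  · have := hY₀ V hV
    refine le_antisymm (fun x hx => ?_) hKV
    have hx0 : x = 0 := congrArg Subtype.val (Subsingleton.elim (⟨x, hx⟩ : V) 0)
    exact hx0 ▸ zero_mem _
  have hYR : Y f.range := hY₁ _ fun x y =>
    Subtype.ext (lie_eq_zero_of_forall_addIdeal_eq_top hR h hA x.2 y.2)
  have hRK : f.range = K.map f :=
    hK.eq_map_of_le_range hY f (fun x hx => by
      obtain ⟨y, -, rfl⟩ := (LieSubalgebra.mem_map _ _ _).1 hx
      exact f.mem_range_self y) hYR le_rfl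
  rw [← hRK] at hKV ⊢
  exact hf.2 V hKV (hsub V hV)

/-- A homomorphism `f`, not necessarily injective, replaces the inclusion of a subalgebra so that
`H` and `K` stay fixed while the induction passes to quotients and subalgebras of `L`. -/
theorem IsProjector.map_of_isProjector_range [CharZero F] {X Y : LieClass.{u, v} F}
    (hX : IsSchunckClass X) (hY : IsSchunckClass Y)
    (hsub : ∀ (L : Type v) [LieRing L] [LieAlgebra F L], Y L → X L) (n : ℕ) :
    ∀ (L : Type v) [LieRing L] [LieAlgebra F L] [FiniteDimensional F L] [LieAlgebra.IsSolvable L]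
      (H : Type v) [LieRing H] [LieAlgebra F H] (f : H →ₗ⁅F⁆ L) (K : LieSubalgebra F H),
      Module.finrank F L = n → IsProjector X f.range → IsProjector Y K →
      IsProjector Y (K.map f) := by
  induction n using Nat.strong_induction_on with
  | _ n ih =>
  intro L _ _ _ _ H _ _ f K hn hf hK
  have hquot : ∀ I : LieIdeal F L, I ≠ ⊥ →
      IsMaximalSubalgebra Y ((K.map f).map (quotientMk I)) := by
    intro I hI
    have := solvable_quotient I
    have hr : ((quotientMk I).comp f).range = f.range.map (quotientMk I) := by
      rw [LieHom.range_eq_map, LieHom.range_eq_map, subalgebra_map_map]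
    have := ih _ (hn ▸ finrank_quotient_lt hI) (L ⧸ I) H ((quotientMk I).comp f) K rfl
      (hr ▸ hf.map hX _ (quotientMk_surjective I)) hK
    rw [← subalgebra_map_map] at this
    exact this.isMaximal hY
  suffices hmax : IsMaximalSubalgebra Y (K.map f) by
    intro I
    by_cases hI : I = ⊥
    · refine hmax.map_equiv hY _ ⟨?_, quotientMk_surjective I⟩
      rw [← LieHom.ker_eq_bot, ker_quotientMk, hI]
    · exact hquot I hI
  have hKf : K.map f ≤ f.range := fun x hx => by
    obtain ⟨y, -, rfl⟩ := (LieSubalgebra.mem_map _ _ _).1 hx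
    exact f.mem_range_self y
  refine ⟨hY.map f (hK.isMaximal hY).1, fun V hKV hV => ?_⟩
  by_cases hR : f.range = ⊤
  · exact hK.eq_map_of_le_range hY f hKV hV (hR ▸ le_top)
  by_cases h : ∀ A : LieIdeal F L, IsAtom A → addIdeal f.range A = ⊤
  · have htop : (⊤ : LieIdeal F L) ≠ ⊥ := fun h₀ => hR <| eq_top_iff.2 fun x _ => by
      have hx : x ∈ (⊤ : LieIdeal F L) := LieSubmodule.mem_top x
      rw [h₀, LieSubmodule.mem_bot] at hx
      exact hx ▸ zero_mem _
    obtain ⟨A, hA, -⟩ := exists_isAtom_le htop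
    exact eq_of_forall_addIdeal_eq_top hY hsub f (hf.isMaximal hX) hK hR h hA hKV hV
  push Not at h
  obtain ⟨A, hA, hT⟩ := h
  set T := addIdeal f.range A
  have := solvable_subalgebra T
  have hfT : f.range ≤ T := le_addIdeal _ _
  let g : H →ₗ⁅F⁆ T := (LieSubalgebra.inclusion hfT).comp f.rangeRestrict
  have hg : T.incl.comp g = f := rfl
  have hgmap : g.range.map T.incl = f.range := by
    rw [LieHom.range_eq_map, subalgebra_map_map, hg, ← LieHom.range_eq_map]
  have hgmax : IsMaximalSubalgebra X g.range := by
    have hfmax := hf.isMaximal hX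
    refine ⟨hX.of_map T.incl Subtype.val_injective (hgmap ▸ hfmax.1), fun W hgW hW => ?_⟩
    have hWf := hfmax.2 (W.map T.incl) (fun x hx => ?_) (hX.map _ hW)
    · refine le_antisymm (fun w hw => ?_) hgW
      have : (w : L) ∈ f.range := hWf ▸ (LieSubalgebra.mem_map _ _ _).2 ⟨w, hw, rfl⟩
      obtain ⟨y, hy⟩ := (LieHom.mem_range _ _).1 this
      exact (LieHom.mem_range _ _).2 ⟨y, Subtype.ext hy⟩
    · rw [← hgmap] at hx
      obtain ⟨y, hy, rfl⟩ := (LieSubalgebra.mem_map _ _ _).1 hx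
      exact (LieSubalgebra.mem_map _ _ _).2 ⟨y, hgW hy, rfl⟩
  have hgproj : IsProjector X g.range := by
    refine hgmax.isProjector hX (A.comap T.incl)
      (fun a ha b hb => Subtype.ext (lie_eq_zero_of_isAtom hA ha hb)) fun x => ?_
    obtain ⟨u, hu, hxu⟩ := mem_addIdeal.1 x.2
    obtain ⟨y, rfl⟩ := (LieHom.mem_range _ _).1 hu
    exact ⟨g y, g.mem_range_self y, hxu⟩
  have hKmax := (ih _ (hn ▸ finrank_lt_of_ne_top hT) T H g K rfl hgproj hK).isMaximal hY
  -- Maximality of the image of `K` modulo `A` gives `V + A = K + A ≤ T`.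
  have hVT : V ≤ T := by
    have hVeq := (hquot A hA.1).2 (V.map (quotientMk A)) (fun y hy => ?_) (hY.map _ hV)
    · intro x hx
      have hx' : quotientMk A x ∈ V.map (quotientMk A) :=
        (LieSubalgebra.mem_map _ _ _).2 ⟨x, hx, rfl⟩
      rw [hVeq] at hx'
      obtain ⟨u, hu, hux⟩ := (LieSubalgebra.mem_map _ _ _).1 hx'
      exact mem_addIdeal.2 ⟨u, hKf hu, (quotientMk_eq A).1 hux.symm⟩
    · obtain ⟨x, hx, rfl⟩ := (LieSubalgebra.mem_map _ _ _).1 hy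
      exact (LieSubalgebra.mem_map _ _ _).2 ⟨x, hKV hx, rfl⟩
  have hVmap : (V.comap T.incl).map T.incl = V := by
    ext x
    simp only [LieSubalgebra.mem_map, LieSubalgebra.mem_comap, LieSubalgebra.coe_incl]
    exact ⟨fun ⟨y, hy, h⟩ => h ▸ hy, fun h => ⟨⟨x, hVT h⟩, h, rfl⟩⟩
  have := hKmax.2 (V.comap T.incl) ?_ (hY.of_map T.incl Subtype.val_injective (hVmap.symm ▸ hV))
  · rw [← hVmap, this, subalgebra_map_map, hg]
  · rw [← LieSubalgebra.map_le_iff_le_comap, subalgebra_map_map, hg]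
    exact hKV

end StrongContainment

end SchunckLie

theorem mainTheorem5 (F : Type u) [Field F] [CharZero F]
    (𝔥 𝔎 : SchunckLie.LieClass.{u, v} F)
    (h𝔥 : SchunckLie.IsSchunckClass 𝔥) (h𝔎 : SchunckLie.IsSchunckClass 𝔎)
    (hsub : ∀ (L : Type v) [LieRing L] [LieAlgebra F L], 𝔎 L → 𝔥 L) :
    SchunckLie.StronglyContains 𝔥 𝔎 := by
  intro L _ _ _ _ H hH K hK
  refine SchunckLie.IsProjector.map_of_isProjector_range h𝔥 h𝔎 hsub _ L H H.incl K rfl ?_ hK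
  rwa [LieSubalgebra.incl_range]
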